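/- Let $G$ be a finite, connected, regular simple graph with vertex set $V$, $|V|\ge 2$. Let $P$ be the transition matrix of the lazy simple random walk on $G$: $P(x,x)=\tfrac12$, $P(x,y)=\tfrac1{2\deg(x)}$ if $\{x,y\}$ is an edge, and $P(x,y)=0$ otherwise. Let $t_{\rm hit}(G)=\max_{x,y\in V}\mathbf E_x[\tau_y]$ be its maximal hitting time, where $\tau_y$ is the first time $t\ge 0$ at which the walk is at $y$. The lamplighter walk on $\mathbf Z_2\wr G$ is the Markov chain on pairs $(f,x)$ with $f\colon V\to\{0,1\}$ and $x\in V$ that, from $(f,x)$, replaces $f_x$ by a uniform random bit, moves from $x$ to $y$ with probability $P(x,y)$, and then replaces the value of the lamp at $y$ by an independent uniform random bit, all other lamps being unchanged. For a reversible irreducible finite Markov chain with eigenvalues $1=\lambda_1>\lambda_2\ge\lambda_3\ge\cdots$ the relaxation time is $t_{\rm rel}=\frac1{1-\lambda_2}$; write $t_{\rm rel}(G)$ for that of $P$ and $t_{\rm rel}(\mathbf Z_2\wr G)$ for that of the lamplighter walk. There are universal constants $0<c_1\le C_1<\infty$, not depending on $G$, such that for every such $G$ the maximal hitting time $t_{\rm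 hit}(G)$ is finite and \[ c_1\, t_{\rm hit}(G)\ \le\ t_{\rm rel}(\mathbf Z_2\wr G)\ \le\ C_1\, t_{\rm hit}(G), \] and moreover \[ t_{\rm rel}(\mathbf Z_2\wr G)\ \le\ \max\Big\{\frac{4}{\log 2}\,t_{\rm hit}(G),\ 2\,t_{\rm rel}(G)\Big\}. \] -/

import Mathlib

open MeasureTheory ProbabilityTheory
open scoped ENNReal

noncomputable section

namespace Lamplighter

/-! ### Finite Markov chains: trajectories, hitting times, relaxation time -/

section Chain

variable {S : Type*} [Fintype S] [DecidableEq S]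

/-- The distribution `P(x, ·)` of the next state, given the current state `x`. -/
def stepPMF (P : Matrix S S ℝ) (hP : P ∈ Matrix.rowStochastic ℝ S) (x : S) : PMF S :=
  PMF.ofFintype (fun y => ENNReal.ofReal (P x y)) (by
    rw [← ENNReal.ofReal_sum_of_nonneg
      (fun y _ => Matrix.nonneg_of_mem_rowStochastic hP),
      Matrix.sum_row_of_mem_rowStochastic hP x, ENNReal.ofReal_one])

/-- The transition kernel from a past `(X₀, …, Xₙ)` to the next state `Xₙ₊₁`; it depends on the
past only through `Xₙ`. -/
def stepKernel [MeasurableSpace S] [DiscreteMeasurableSpace S]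
    (P : Matrix S S ℝ) (hP : P ∈ Matrix.rowStochastic ℝ S) (n : ℕ) :
    Kernel (Finset.Iic n → S) S :=
  Kernel.ofFunOfCountable fun h => (stepPMF P hP (h ⟨n, Finset.mem_Iic.2 le_rfl⟩)).toMeasure

instance stepKernel.instIsMarkovKernel [MeasurableSpace S] [DiscreteMeasurableSpace S]
    (P : Matrix S S ℝ) (hP : P ∈ Matrix.rowStochastic ℝ S) (n : ℕ) :
    IsMarkovKernel (stepKernel P hP n) :=
  ⟨fun h => PMF.toMeasure.isProbabilityMeasure
    (stepPMF P hP (h ⟨n, Finset.mem_Iic.2 le_rfl⟩))⟩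

/-- The law on trajectories of the Markov chain with transition matrix `P` started at `x`. -/
def chainLaw [MeasurableSpace S] [DiscreteMeasurableSpace S]
    (P : Matrix S S ℝ) (hP : P ∈ Matrix.rowStochastic ℝ S) (x : S) : Measure (ℕ → S) :=
  Kernel.traj (X := fun _ => S) (stepKernel P hP) 0 (fun _ => x)

/-- The first time `t ≥ 0` at which the trajectory `ω` is at `y` (`∞` if there is none). -/
def hittingTime (y : S) (ω : ℕ → S) : ℝ≥0∞ :=
  ⨅ (t : ℕ) (_ : ω t = y), (t : ℝ≥0∞)

/-- The maximal hitting time `max_{x,y} E_x[τ_y]`. -/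
def maxHittingTime (P : Matrix S S ℝ) (hP : P ∈ Matrix.rowStochastic ℝ S) : ℝ≥0∞ :=
  letI : MeasurableSpace S := ⊤
  ⨆ (x : S) (y : S), ∫⁻ ω, hittingTime y ω ∂(chainLaw P hP x)

/-- The second largest eigenvalue `λ₂` of the transition matrix of a reversible chain: the largest
eigenvalue after one copy of the top eigenvalue `1` is removed, multiplicities being counted. -/
def secondEigenvalue (P : Matrix S S ℝ) : ℝ :=
  sSup {l : ℝ | Module.End.HasEigenvalue (Matrix.toLin' P) l ∧
    (l = 1 → 2 ≤ Module.finrank ℝ (Module.End.eigenspace (Matrix.toLin' P) 1))}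

/-- The relaxation time `1 / (1 - λ₂)`. -/
def relaxationTime (P : Matrix S S ℝ) : ℝ :=
  1 / (1 - secondEigenvalue P)

end Chain

/-! ### The lazy random walk on a graph and the lamplighter walk over it -/

section Walk

variable {V : Type*} [Fintype V] [DecidableEq V]

/-- Transition matrix of the lazy simple random walk on `G`. -/
def lazyWalk (G : SimpleGraph V) [DecidableRel G.Adj] : Matrix V V ℝ := fun x y =>
  if x = y then 1 / 2 else if G.Adj x y then 1 / (2 * (G.degree x : ℝ)) else 0

theorem lazyWalk_mem_rowStochastic [Nontrivial V] (G : SimpleGraph V) [DecidableRel G.Adj]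
    (hG : G.Connected) : lazyWalk G ∈ Matrix.rowStochastic ℝ V := by
  rw [Matrix.mem_rowStochastic_iff_sum]
  refine ⟨fun x y => ?_, fun x => ?_⟩
  · unfold lazyWalk
    split_ifs <;> positivity
  · have hd : 0 < G.degree x := hG.preconnected.degree_pos_of_nontrivial x
    have hd' : (G.degree x : ℝ) ≠ 0 := by positivity
    have h : ∀ y, lazyWalk G x y =
        (if x = y then 1 / 2 else 0) + (if G.Adj x y then 1 / (2 * (G.degree x : ℝ)) else 0) := by
      intro y
      unfold lazyWalk
      by_cases hxy : x = y
      · subst hxy; simp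
      · simp [hxy]
    simp only [h, Finset.sum_add_distrib, Finset.sum_ite_eq, Finset.mem_univ, if_true]
    rw [← Finset.sum_filter, Finset.sum_const, ← SimpleGraph.neighborFinset_eq_filter,
      SimpleGraph.card_neighborFinset_eq_degree, nsmul_eq_mul]
    field_simp
    norm_num

/-- Transition matrix of the lamplighter walk on `ℤ₂ ≀ G` over a walk on `V` with transition
matrix `P`. A state is a lamp configuration together with a position. From `(f, x)` the lamp at `x`
is set to a uniform value `a`, the lamplighter moves to `y` with probability `P x y`, and the lamp
at `y` is set to an independent uniform value `b`. -/
def lamplighterWalk (P : Matrix V V ℝ) : Matrix ((V → ZMod 2) × V) ((V → ZMod 2) × V) ℝ :=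
  fun s t => P s.2 t.2 * ∑ a : ZMod 2, ∑ b : ZMod 2,
    if Function.update (Function.update s.1 s.2 a) t.2 b = t.1 then (1 / 4 : ℝ) else 0

end Walk

end Lamplighter

end

open MeasureTheory ProbabilityTheory
open scoped ENNReal

/-! Write `T` for the maximal hitting time. The constants obtained are 1/2 and 1, and the last bound
follows because 4 / log 2 ≥ 1.

Upper bound: every nontrivial lamplighter eigenvalue `l` is at most 1 - 1/T. If its eigenfunction
depends on the lamp at `o`, its change under switching that lamp is again an eigenfunction. For `l >
0` this change vanishes when the walker is at `o`, where the lamp is refreshed. Its largest absolute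
value over lamp configurations is a function `g ≥ 0` with `g o = 0` and `l g ≤ P g` off `o`.
Comparing `g` with `h x = E_x[τ_o]`, which satisfies `h = 1 + P h` off `o`, gives the bound
(`le_one_sub_of_killed`). If the eigenfunction ignores the lamps, it is an eigenfunction of `P`, and
subtracting its minimum gives a suitable `g`.

Lower bound: an eigenfunction `v` of the walk killed at `o` lifts to `(-1)^(f o) * v x`. Choose `o`
whose mean hitting time from the uniform distribution is at least T/2 (triangle inequality and
random target lemma). The Rayleigh quotient of `h` for the killed matrix then gives an eigenvalue
`μ` with 1 - μ ≤ 2/T.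

Finiteness of `T` and the harmonic-function arguments rest on the maximum principle, which is where
connectedness enters. -/

noncomputable section

namespace Lamplighter

/-! ### Expected hitting times by first-step analysis -/

section HittingTimes

variable {S : Type*}

/-- The trajectory `ω` stays away from `y` up to time `n`, included. -/
def avoids (y : S) (n : ℕ) : Set (ℕ → S) := {ω | ∀ t ≤ n, ω t ≠ y}

/-- Tail-sum formula: the `n`-th indicator records that the hitting time exceeds `n`. -/
theorem hittingTime_eq_tsum (y : S) (ω : ℕ → S) :
    hittingTime y ω = ∑' n : ℕ, (avoids y n).indicator (fun _ => (1 : ℝ≥0∞)) ω := by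
  classical
  by_cases h : ∃ t, ω t = y
  · have h1 : hittingTime y ω = (Nat.find h : ℝ≥0∞) := by
      apply le_antisymm
      · exact iInf₂_le (f := fun (t : ℕ) (_ : ω t = y) => (t : ℝ≥0∞)) _ (Nat.find_spec h)
      · refine le_iInf₂ fun t ht => ?_
        exact_mod_cast Nat.find_min' h ht
    rw [h1, tsum_eq_sum (s := Finset.range (Nat.find h))]
    · rw [Finset.sum_congr rfl (g := fun _ => (1 : ℝ≥0∞))]
      · simp
      · intro n hn
        refine Set.indicator_of_mem ?_ _
        intro t ht
        exact Nat.find_min h (lt_of_le_of_lt ht (Finset.mem_range.1 hn))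
    · intro n hn
      refine Set.indicator_of_notMem ?_ _
      intro hω
      exact hω (Nat.find h) (by simpa using hn) (Nat.find_spec h)
  · push Not at h
    have h1 : hittingTime y ω = ⊤ := by
      simp [hittingTime, h]
    have h2 : ∀ n, (avoids y n).indicator (fun _ => (1 : ℝ≥0∞)) ω = 1 :=
      fun n => Set.indicator_of_mem (s := avoids y n) (fun t _ => h t) _
    simp_rw [h1, h2]
    rw [ENNReal.tsum_const_eq_top_of_ne_zero one_ne_zero]

theorem measurableSet_avoids [MeasurableSpace S] [DiscreteMeasurableSpace S]
    (y : S) (n : ℕ) : MeasurableSet (avoids y n) := by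
  have : avoids y n = ⋂ t, ⋂ (_ : t ≤ n), (fun ω : ℕ → S => ω t) ⁻¹' {y}ᶜ := by
    ext ω; simp [avoids]
  rw [this]
  exact MeasurableSet.iInter fun t => MeasurableSet.iInter fun _ =>
    measurable_pi_apply t (MeasurableSet.of_discrete)

variable [Fintype S] [DecidableEq S]

/-- `E_x[φ(X_n); X_0, …, X_n ≠ y]`, computed by first-step analysis. -/
def killedExp (P : Matrix S S ℝ) (y : S) (φ : S → ℝ≥0∞) : ℕ → S → ℝ≥0∞
  | 0, x => if x = y then 0 else φ x
  | n + 1, x => if x = y then 0 else ∑ z, ENNReal.ofReal (P x z) * killedExp P y φ n z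

/-- The definition peels off the first step. This form peels off the last one, as needed for a
trajectory law built by appending states. -/
theorem killedExp_succ' (P : Matrix S S ℝ) (y : S) (n : ℕ) (φ : S → ℝ≥0∞) (x : S) :
    killedExp P y φ (n + 1) x =
      killedExp P y
        (fun w => ∑ z, ENNReal.ofReal (P w z) * if z = y then 0 else φ z) n x := by
  induction n generalizing x with
  | zero => simp [killedExp]
  | succ n ih =>
    rw [killedExp, killedExp]
    simp_rw [ih]

variable [MeasurableSpace S] [DiscreteMeasurableSpace S]

theorem lintegral_stepPMF (P : Matrix S S ℝ) (hP : P ∈ Matrix.rowStochastic ℝ S) (x : S)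
    (φ : S → ℝ≥0∞) :
    ∫⁻ z, φ z ∂(stepPMF P hP x).toMeasure = ∑ z, ENNReal.ofReal (P x z) * φ z := by
  rw [lintegral_fintype]
  refine Finset.sum_congr rfl fun z _ => ?_
  rw [PMF.toMeasure_apply_singleton _ _ (MeasurableSet.singleton z), mul_comm]
  rfl

theorem chainLaw_zero (P : Matrix S S ℝ) (hP : P ∈ Matrix.rowStochastic ℝ S) (x : S)
    (φ : S → ℝ≥0∞) :
    ∫⁻ ω, φ (ω 0) ∂(chainLaw P hP x) = φ x := by
  have h := Kernel.traj_map_frestrictLe_apply (X := fun _ => S) (κ := stepKernel P hP) 0 0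
    (fun _ => x)
  have h2 : ∫⁻ ω, φ (ω 0) ∂(chainLaw P hP x) =
      ∫⁻ h, φ (h ⟨0, by simp⟩) ∂((chainLaw P hP x).map
        (Preorder.frestrictLe (π := fun _ => S) 0)) := by
    rw [lintegral_map (by fun_prop) (by fun_prop)]
    rfl
  rw [h2, chainLaw, h, Kernel.partialTraj_self, Kernel.id_apply, lintegral_dirac' _ (by fun_prop)]

/-- The Markov property at time `n`, for a test function of the next state. -/
theorem chainLaw_markov (P : Matrix S S ℝ) (hP : P ∈ Matrix.rowStochastic ℝ S) (x y : S) (n : ℕ)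
    (φ : S → ℝ≥0∞) :
    ∫⁻ ω, (avoids y n).indicator (fun ω => φ (ω (n + 1))) ω ∂(chainLaw P hP x) =
      ∫⁻ ω, (avoids y n).indicator (fun ω => ∑ z, ENNReal.ofReal (P (ω n) z) * φ z) ω
        ∂(chainLaw P hP x) := by
  -- The joint law of the past and the next state is the law of the past composed with the step
  -- kernel, so the next state can be integrated out first.
  have h := Kernel.partialTraj_compProd_eq_map_traj (X := fun _ => S) (κ := stepKernel P hP)
    (Nat.zero_le n) (x₀ := fun _ => x)
  have h' := Kernel.traj_map_frestrictLe_apply (X := fun _ => S) (κ := stepKernel P hP) 0 n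
    (fun _ => x)
  let A : Set (Finset.Iic n → S) := {p | ∀ t, p t ≠ y}
  have hA : MeasurableSet A := (Set.toFinite A).measurableSet
  have hmem : ∀ ω : ℕ → S,
      Preorder.frestrictLe (π := fun _ => S) n ω ∈ A ↔ ω ∈ avoids y n := by
    intro ω
    simp [A, avoids, Preorder.frestrictLe]
  have e1 : ∫⁻ ω, (avoids y n).indicator (fun ω => φ (ω (n + 1))) ω ∂(chainLaw P hP x) =
      ∫⁻ q, A.indicator 1 q.1 * φ q.2 ∂((chainLaw P hP x).map
        (fun ω => (Preorder.frestrictLe (π := fun _ => S) n ω, ω (n + 1)))) := by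
    rw [lintegral_map]
    · refine lintegral_congr fun ω => ?_
      by_cases hω : ω ∈ avoids y n
      · simp [hω, (hmem ω).2 hω]
      · have : Preorder.frestrictLe (π := fun _ => S) n ω ∉ A := fun h => hω ((hmem ω).1 h)
        simp [hω, this]
    · refine Measurable.mul ?_ ?_
      · exact (measurable_one.indicator hA).comp measurable_fst
      · exact Measurable.of_discrete.comp measurable_snd
    · fun_prop
  have e2 : ∫⁻ ω, (avoids y n).indicator (fun ω => ∑ z, ENNReal.ofReal (P (ω n) z) * φ z) ω
        ∂(chainLaw P hP x) =
      ∫⁻ p, A.indicator 1 p * ∑ z, ENNReal.ofReal (P (p ⟨n, by simp⟩) z) * φ z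
        ∂((chainLaw P hP x).map (Preorder.frestrictLe (π := fun _ => S) n)) := by
    rw [lintegral_map Measurable.of_discrete (by fun_prop)]
    refine lintegral_congr fun ω => ?_
    by_cases hω : ω ∈ avoids y n
    · simp only [Set.indicator_of_mem hω, Set.indicator_of_mem ((hmem ω).2 hω), Pi.one_apply,
        one_mul]
      rfl
    · have : Preorder.frestrictLe (π := fun _ => S) n ω ∉ A := fun h => hω ((hmem ω).1 h)
      simp [hω, this]
  rw [e1, e2]
  unfold chainLaw
  rw [← h, h', Measure.lintegral_compProd]
  · refine lintegral_congr fun p => ?_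
    have := lintegral_stepPMF P hP (p ⟨n, Finset.mem_Iic.2 le_rfl⟩) φ
    rw [← this]
    have hk : stepKernel P hP n p =
        (stepPMF P hP (p ⟨n, Finset.mem_Iic.2 le_rfl⟩)).toMeasure := rfl
    rw [← hk]
    exact lintegral_const_mul (A.indicator 1 p) (Measurable.of_discrete (f := φ))
  · refine Measurable.mul ?_ ?_
    · exact (measurable_one.indicator hA).comp measurable_fst
    · exact Measurable.of_discrete.comp measurable_snd

theorem lintegral_avoids (P : Matrix S S ℝ) (hP : P ∈ Matrix.rowStochastic ℝ S) (x y : S) (n : ℕ)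
    (φ : S → ℝ≥0∞) :
    ∫⁻ ω, (avoids y n).indicator (fun ω => φ (ω n)) ω ∂(chainLaw P hP x) =
      killedExp P y φ n x := by
  induction n generalizing φ with
  | zero =>
    have := chainLaw_zero P hP x (fun z => if z = y then 0 else φ z)
    rw [killedExp, ← this]
    refine lintegral_congr fun ω => ?_
    by_cases h : ω 0 = y <;> simp [avoids, h, Set.indicator]
  | succ n ih =>
    rw [killedExp_succ', ← ih, ← chainLaw_markov]
    refine lintegral_congr fun ω => ?_
    by_cases hn : ω ∈ avoids y n
    · by_cases h : ω (n + 1) = y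
      · have : ω ∉ avoids y (n + 1) := fun hh => hh (n + 1) le_rfl h
        simp [hn, h, this]
      · have : ω ∈ avoids y (n + 1) := by
          intro t ht
          rcases Nat.lt_or_ge t (n + 1) with h1 | h1
          · exact hn t (by omega)
          · obtain rfl : t = n + 1 := by omega
            exact h
        simp [hn, h, this]
    · have : ω ∉ avoids y (n + 1) := fun hh => hn fun t ht => hh t (by omega)
      simp [hn, this]

theorem lintegral_hittingTime (P : Matrix S S ℝ) (hP : P ∈ Matrix.rowStochastic ℝ S) (x y : S) :
    ∫⁻ ω, hittingTime y ω ∂(chainLaw P hP x) = ∑' n, killedExp P y (fun _ => 1) n x := by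
  simp_rw [hittingTime_eq_tsum]
  rw [lintegral_tsum fun n =>
    ((measurable_const.indicator (measurableSet_avoids y n)).aemeasurable)]
  exact tsum_congr fun n => lintegral_avoids P hP x y n (fun _ => 1)

theorem lintegral_hittingTime_self (P : Matrix S S ℝ) (hP : P ∈ Matrix.rowStochastic ℝ S)
    (y : S) : ∫⁻ ω, hittingTime y ω ∂(chainLaw P hP y) = 0 := by
  rw [lintegral_hittingTime, ENNReal.tsum_eq_zero]
  rintro (_ | n) <;> simp [killedExp]

theorem lintegral_hittingTime_of_ne (P : Matrix S S ℝ) (hP : P ∈ Matrix.rowStochastic ℝ S)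
    {x y : S} (hxy : x ≠ y) : ∫⁻ ω, hittingTime y ω ∂(chainLaw P hP x) =
      1 + ∑ z, ENNReal.ofReal (P x z) * ∫⁻ ω, hittingTime y ω ∂(chainLaw P hP z) := by
  simp_rw [lintegral_hittingTime]
  rw [tsum_eq_zero_add' ENNReal.summable]
  simp only [killedExp, hxy, if_false]
  congr 1
  rw [Summable.tsum_finsetSum fun _ _ => ENNReal.summable]
  exact Finset.sum_congr rfl fun z _ => ENNReal.tsum_mul_left

/-- A nonnegative solution `g` of `g ≥ 1 + P g` off `y` dominates the expected hitting time. -/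
theorem lintegral_hittingTime_le_of_supersolution (P : Matrix S S ℝ)
    (hP : P ∈ Matrix.rowStochastic ℝ S) (y : S) (g : S → ℝ) (hg : ∀ x, 0 ≤ g x)
    (hsup : ∀ x, x ≠ y → 1 + ∑ z, P x z * g z ≤ g x) (x : S) :
    ∫⁻ ω, hittingTime y ω ∂(chainLaw P hP x) ≤ ENNReal.ofReal (g x) := by
  rw [lintegral_hittingTime, ENNReal.tsum_eq_iSup_nat]
  -- Each truncated expectation is bounded by `g`, by induction on the truncation level, so no
  -- finiteness has to be known beforehand.
  refine iSup_le fun N => ?_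
  induction N generalizing x with
  | zero => simp
  | succ N ih =>
    rw [Finset.sum_range_succ']
    by_cases hxy : x = y
    · simp [killedExp, hxy]
    · refine le_trans ?_ (ENNReal.ofReal_le_ofReal (hsup x hxy))
      have hPn : ∀ z, 0 ≤ P x z := fun z => Matrix.nonneg_of_mem_rowStochastic hP
      rw [add_comm, ENNReal.ofReal_add zero_le_one
        (Finset.sum_nonneg fun z _ => mul_nonneg (hPn z) (hg z)), ENNReal.ofReal_one,
        ENNReal.ofReal_sum_of_nonneg fun z _ => mul_nonneg (hPn z) (hg z)]
      simp only [killedExp, hxy, if_false]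
      rw [Finset.sum_comm]
      gcongr with z _
      rw [← Finset.mul_sum, ENNReal.ofReal_mul (hPn z)]
      gcongr
      exact ih z

end HittingTimes

/-! ### The maximum principle and solvability of the hitting time equation -/

section MaximumPrinciple

variable {V : Type*} [Fintype V]

/-- A function which is `P`-subharmonic off a single point is largest at that point. -/
def MaximumPrinciple (P : Matrix V V ℝ) : Prop :=
  ∀ (o : V) (u : V → ℝ), (∀ x, x ≠ o → u x ≤ ∑ z, P x z * u z) → ∀ x, u x ≤ u o

variable {P : Matrix V V ℝ}

theorem MaximumPrinciple.eq_of_harmonic (hmax : MaximumPrinciple P) {u : V → ℝ}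
    (hu : ∀ x, u x = ∑ z, P x z * u z) (x y : V) : u x = u y :=
  le_antisymm (hmax y u (fun z _ => (hu z).le) x) (hmax x u (fun z _ => (hu z).le) y)

variable [DecidableEq V]

/-- At a maximum point other than `o`, a weighted sum of the nonnegative gaps to the maximum is at
most 0, so every neighbour is a maximum point too. Connectedness carries this along a path to `o`.
-/
theorem lazyWalk_maximumPrinciple [Nontrivial V] (G : SimpleGraph V) [DecidableRel G.Adj]
    (hG : G.Connected) : MaximumPrinciple (lazyWalk G) := by
  intro o u hu x
  have hP := lazyWalk_mem_rowStochastic G hG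
  obtain ⟨m, -, hm⟩ := Finset.exists_max_image Finset.univ u ⟨o, Finset.mem_univ o⟩
  have hm' : ∀ z, u z ≤ u m := fun z => hm z (Finset.mem_univ z)
  have key : ∀ a b : V, G.Walk a b → b = o → u a = u m → u o = u m := by
    intro a b w
    induction w with
    | nil => rintro rfl h; exact h
    | @cons a c b hac w ih =>
      intro hb ha
      by_cases hao : a = o
      · rw [← hao, ha]
      refine ih hb ?_
      have h1 : ∑ z, lazyWalk G a z * (u m - u z) ≤ 0 := by
        have h2 := hu a hao
        have h3 := Matrix.sum_row_of_mem_rowStochastic hP a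
        simp_rw [mul_sub, Finset.sum_sub_distrib, ← Finset.sum_mul, h3]
        linarith
      have hnn : ∀ z ∈ Finset.univ, 0 ≤ lazyWalk G a z * (u m - u z) := fun z _ =>
        mul_nonneg (Matrix.nonneg_of_mem_rowStochastic hP) (sub_nonneg.2 (hm' z))
      have h4 := (Finset.sum_eq_zero_iff_of_nonneg hnn).1
        (le_antisymm h1 (Finset.sum_nonneg hnn)) c (Finset.mem_univ c)
      have hpos : lazyWalk G a c ≠ 0 := by
        have : 0 < G.degree a := hG.preconnected.degree_pos_of_nontrivial a
        have : (0 : ℝ) < G.degree a := by exact_mod_cast this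
        simp only [lazyWalk, hac.ne, hac, if_false, if_true]
        positivity
      have := (mul_eq_zero.1 h4).resolve_left hpos
      linarith
  obtain ⟨w⟩ := hG.preconnected m o
  rw [key m o w rfl rfl]
  exact hm' x

/-- This is where regularity enters: the walk is reversible for the uniform distribution. -/
theorem lazyWalk_symm (G : SimpleGraph V) [DecidableRel G.Adj] {d : ℕ}
    (hreg : G.IsRegularOfDegree d) (x y : V) : lazyWalk G x y = lazyWalk G y x := by
  simp only [lazyWalk, hreg.degree_eq, G.adj_comm x y, eq_comm (a := x)]

/-- `E_x[τ_y]` solves `h = 1 + P h` off `y`; the equation has a nonnegative solution. -/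
theorem MaximumPrinciple.exists_solution (hmax : MaximumPrinciple P) (y : V) :
    ∃ g : V → ℝ, (∀ x, 0 ≤ g x) ∧ ∀ x, x ≠ y → g x = 1 + ∑ z, P x z * g z := by
  -- `T` is the identity at `y` and `1 - P` elsewhere. The maximum principle for `u` and `-u` makes
  -- it injective, hence surjective by finite dimension.
  let T : (V → ℝ) →ₗ[ℝ] (V → ℝ) :=
    { toFun := fun u x => if x = y then u x else u x - ∑ z, P x z * u z
      map_add' := by
        intro u v
        ext x
        by_cases h : x = y
        · simp [h]
        · simp only [h, if_false, Pi.add_apply, mul_add, Finset.sum_add_distrib]; ring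
      map_smul' := by
        intro c u
        ext x
        by_cases h : x = y
        · simp [h]
        · simp only [h, if_false, Pi.smul_apply, smul_eq_mul, RingHom.id_apply, mul_sub,
            Finset.mul_sum]
          congr 1
          exact Finset.sum_congr rfl fun z _ => by ring }
  have hT : ∀ u x, T u x = if x = y then u x else u x - ∑ z, P x z * u z := fun _ _ => rfl
  have hinj : Function.Injective T := by
    rw [injective_iff_map_eq_zero]
    intro u hu
    have hy : u y = 0 := by simpa [hT] using congrFun hu y
    have hx : ∀ x, x ≠ y → u x = ∑ z, P x z * u z := fun x hx => by
      have := congrFun hu x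
      rw [hT, if_neg hx] at this
      exact sub_eq_zero.1 this
    ext x
    refine le_antisymm ?_ ?_
    · exact (hmax y u (fun x h => (hx x h).le) x).trans_eq hy
    · have := hmax y (-u) (fun x h => by simp [hx x h]) x
      simp only [Pi.neg_apply, hy] at this
      simp only [Pi.zero_apply]
      linarith
  obtain ⟨g, hg⟩ := LinearMap.injective_iff_surjective.1 hinj (fun x => if x = y then 0 else 1)
  have hy : g y = 0 := by simpa [hT] using congrFun hg y
  have hx : ∀ x, x ≠ y → g x = 1 + ∑ z, P x z * g z := fun x hx => by
    have := congrFun hg x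
    rw [hT, if_neg hx, if_neg hx] at this
    linarith
  refine ⟨g, fun x => ?_, hx⟩
  have := hmax y (-g) (fun x h => by
    simp only [Pi.neg_apply, mul_neg, Finset.sum_neg_distrib, hx x h]; linarith) x
  simp only [Pi.neg_apply, hy] at this
  linarith

end MaximumPrinciple

/-! ### Kac's formula, the random target lemma, and a good target -/

section MeanHittingTimes

variable {V : Type*} [Fintype V] [DecidableEq V]

/-- The mean hitting time `E_x[τ_y]`. -/
def meanHit (P : Matrix V V ℝ) (hP : P ∈ Matrix.rowStochastic ℝ V) (x y : V) : ℝ≥0∞ :=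
  letI : MeasurableSpace V := ⊤
  ∫⁻ ω, hittingTime y ω ∂(chainLaw P hP x)

variable {P : Matrix V V ℝ} (hP : P ∈ Matrix.rowStochastic ℝ V)

theorem meanHit_ne_top (hmax : MaximumPrinciple P) (x y : V) : meanHit P hP x y ≠ ⊤ := by
  let _ : MeasurableSpace V := ⊤
  obtain ⟨g, hg, hg'⟩ := hmax.exists_solution y
  exact ((lintegral_hittingTime_le_of_supersolution P hP y g hg
    (fun x hx => (hg' x hx).ge) x).trans_lt ENNReal.ofReal_lt_top).ne

theorem toReal_meanHit_self (y : V) : (meanHit P hP y y).toReal = 0 := by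
  let _ : MeasurableSpace V := ⊤
  have : meanHit P hP y y = 0 := lintegral_hittingTime_self P hP y
  simp [this]

theorem toReal_meanHit_of_ne (hmax : MaximumPrinciple P) {x y : V} (hxy : x ≠ y) :
    (meanHit P hP x y).toReal = 1 + ∑ z, P x z * (meanHit P hP z y).toReal := by
  let _ : MeasurableSpace V := ⊤
  have h : meanHit P hP x y = 1 + ∑ z, ENNReal.ofReal (P x z) * meanHit P hP z y :=
    lintegral_hittingTime_of_ne P hP hxy
  have hfin : ∀ z, ENNReal.ofReal (P x z) * meanHit P hP z y ≠ ⊤ := fun z =>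
    ENNReal.mul_ne_top ENNReal.ofReal_ne_top (meanHit_ne_top hP hmax z y)
  rw [h, ENNReal.toReal_add ENNReal.one_ne_top (by simp [hfin]),
    ENNReal.toReal_sum fun z _ => hfin z]
  simp only [ENNReal.toReal_one, ENNReal.toReal_mul]
  congr 1
  refine Finset.sum_congr rfl fun z _ => ?_
  rw [ENNReal.toReal_ofReal (Matrix.nonneg_of_mem_rowStochastic hP)]

theorem one_le_toReal_meanHit (hmax : MaximumPrinciple P)
    {x o : V} (hx : x ≠ o) : 1 ≤ (meanHit P hP x o).toReal := by
  rw [toReal_meanHit_of_ne hP hmax hx]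
  have := Finset.sum_nonneg fun z (_ : z ∈ Finset.univ) =>
    mul_nonneg (Matrix.nonneg_of_mem_rowStochastic hP (i := x) (j := z))
      (ENNReal.toReal_nonneg (a := meanHit P hP z o))
  linarith

theorem maxHittingTime_eq_iSup : maxHittingTime P hP = ⨆ x, ⨆ y, meanHit P hP x y := rfl

theorem maxHittingTime_ne_top (hmax : MaximumPrinciple P) : maxHittingTime P hP ≠ ⊤ := by
  rw [maxHittingTime_eq_iSup]
  have hsum : ∑ x, ∑ y, meanHit P hP x y < ⊤ :=
    ENNReal.sum_lt_top.2 fun x _ => ENNReal.sum_lt_top.2 fun y _ =>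
      (meanHit_ne_top hP hmax x y).lt_top
  have hle : ⨆ x, ⨆ y, meanHit P hP x y ≤ ∑ x, ∑ y, meanHit P hP x y := by
    refine iSup_le fun x => iSup_le fun y => ?_
    refine le_trans ?_ (Finset.single_le_sum_of_canonicallyOrdered (Finset.mem_univ x))
    exact Finset.single_le_sum_of_canonicallyOrdered (f := fun y => meanHit P hP x y)
      (Finset.mem_univ y)
  exact (hle.trans_lt hsum).ne

theorem toReal_meanHit_le (hmax : MaximumPrinciple P) (x y : V) :
    (meanHit P hP x y).toReal ≤ (maxHittingTime P hP).toReal := by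
  refine ENNReal.toReal_mono (maxHittingTime_ne_top hP hmax) ?_
  rw [maxHittingTime_eq_iSup]
  exact le_iSup₂ (f := fun x y => meanHit P hP x y) x y

theorem toReal_maxHittingTime_le (hmax : MaximumPrinciple P) {c : ℝ} (hc : 0 ≤ c)
    (h : ∀ x y, (meanHit P hP x y).toReal ≤ c) : (maxHittingTime P hP).toReal ≤ c := by
  refine ENNReal.toReal_le_of_le_ofReal hc ?_
  rw [maxHittingTime_eq_iSup]
  exact iSup₂_le fun x y =>
    (ENNReal.le_ofReal_iff_toReal_le (meanHit_ne_top hP hmax x y) hc).2 (h x y)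

variable (hsymm : ∀ x y, P x y = P y x) (hmax : MaximumPrinciple P)

include hsymm hmax

/-- The mean hitting time equation, with the value at the target given by Kac's formula. -/
theorem toReal_meanHit_eq (x y : V) :
    (meanHit P hP x y).toReal = 1 + ∑ z, P x z * (meanHit P hP z y).toReal -
      if x = y then (Fintype.card V : ℝ) else 0 := by
  by_cases hxy : x = y
  swap
  · rw [if_neg hxy, sub_zero, toReal_meanHit_of_ne hP hmax hxy]
  subst hxy
  have hcol : ∀ z, ∑ w, P w z = 1 := fun z => by
    rw [← Matrix.sum_row_of_mem_rowStochastic hP z]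
    exact Finset.sum_congr rfl fun w _ => hsymm w z
  have h1 : ∑ w, ∑ z, P w z * (meanHit P hP z x).toReal = ∑ z, (meanHit P hP z x).toReal := by
    rw [Finset.sum_comm]
    refine Finset.sum_congr rfl fun z _ => ?_
    rw [← Finset.sum_mul, hcol, one_mul]
  -- The summand vanishes off `x`. Since column sums are 1, the two hitting-time terms cancel in the
  -- total, leaving minus the number of states.
  have h2 : ∑ w, ((meanHit P hP w x).toReal - 1 - ∑ z, P w z * (meanHit P hP z x).toReal) =
      (meanHit P hP x x).toReal - 1 - ∑ z, P x z * (meanHit P hP z x).toReal := by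
    refine Finset.sum_eq_single x (fun w _ hw => ?_) (by simp)
    rw [toReal_meanHit_of_ne hP hmax hw]
    ring
  rw [Finset.sum_sub_distrib, Finset.sum_sub_distrib, h1] at h2
  simp only [Finset.sum_const, Finset.card_univ, nsmul_eq_mul, mul_one] at h2
  rw [if_pos rfl]
  linarith

/-- The random target lemma. -/
theorem sum_meanHit_eq (x x' : V) :
    ∑ y, (meanHit P hP x y).toReal = ∑ y, (meanHit P hP x' y).toReal := by
  -- Summed over targets, the constants 1 cancel against the single Kac term, so the sum is
  -- harmonic.
  refine hmax.eq_of_harmonic (u := fun x => ∑ y, (meanHit P hP x y).toReal) (fun x => ?_) x x'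
  simp_rw [Finset.mul_sum]
  rw [Finset.sum_comm, Finset.sum_congr rfl fun y _ => toReal_meanHit_eq hP hsymm hmax x y]
  simp [Finset.sum_add_distrib]

/-- As a function of the starting point, `E[τ_z] - E[τ_y]` is subharmonic off `y`, hence largest at
`y`. This replaces an appeal to the strong Markov property. -/
theorem meanHit_triangle (x y z : V) :
    (meanHit P hP x z).toReal ≤ (meanHit P hP x y).toReal + (meanHit P hP y z).toReal := by
  have h := hmax y (fun x => (meanHit P hP x z).toReal - (meanHit P hP x y).toReal) (fun w hw => by
    simp_rw [mul_sub, Finset.sum_sub_distrib]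
    rw [toReal_meanHit_eq hP hsymm hmax w z, toReal_meanHit_eq hP hsymm hmax w y, if_neg hw]
    have : (0 : ℝ) ≤ if w = z then (Fintype.card V : ℝ) else 0 := by positivity
    linarith) x
  simp only [toReal_meanHit_self] at h
  linarith

/-- Some target `o` is hit from the uniform distribution in mean time at least half the maximal
hitting time. -/
theorem exists_maxHittingTime_le [Nonempty V] : ∃ o : V,
    Fintype.card V * (maxHittingTime P hP).toReal ≤ 2 * ∑ x, (meanHit P hP x o).toReal := by
  have hn : (0 : ℝ) < Fintype.card V := by exact_mod_cast Fintype.card_pos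
  obtain ⟨o, -, ho⟩ := Finset.exists_max_image Finset.univ
    (fun y => ∑ x, (meanHit P hP x y).toReal) Finset.univ_nonempty
  have ho' := fun y => ho y (Finset.mem_univ y)
  refine ⟨o, ?_⟩
  rw [mul_comm, ← le_div_iff₀ hn]
  refine toReal_maxHittingTime_le hP hmax (by positivity) fun a b => ?_
  rw [le_div_iff₀ hn]
  have h1 : ∑ c : V, (meanHit P hP a b).toReal ≤
      ∑ c, ((meanHit P hP a c).toReal + (meanHit P hP c b).toReal) :=
    Finset.sum_le_sum fun c _ => meanHit_triangle hP hsymm hmax a c b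
  rw [Finset.sum_add_distrib] at h1
  simp only [Finset.sum_const, Finset.card_univ, nsmul_eq_mul] at h1
  -- By the random target lemma the row sum at `a` is the average of all row sums, hence of all
  -- column sums, and `o` has the largest column sum.
  have h2 : Fintype.card V * ∑ c, (meanHit P hP a c).toReal ≤
      Fintype.card V * ∑ x, (meanHit P hP x o).toReal := by
    calc Fintype.card V * ∑ c, (meanHit P hP a c).toReal
        = ∑ x, ∑ c, (meanHit P hP x c).toReal := by
          rw [Finset.sum_congr rfl fun x _ => sum_meanHit_eq hP hsymm hmax x a]
          simp
      _ = ∑ c, ∑ x, (meanHit P hP x c).toReal := Finset.sum_comm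
      _ ≤ ∑ _c : V, ∑ x, (meanHit P hP x o).toReal := Finset.sum_le_sum fun c _ => ho' c
      _ = _ := by simp
  have h3 := le_of_mul_le_mul_left h2 hn
  have h4 := ho' b
  linarith

end MeanHittingTimes

/-! ### Eigenvalue bounds from hitting times and Rayleigh quotients -/

section SpectralBounds

variable {V : Type*} [Fintype V] [DecidableEq V]

/-- A nonnegative function vanishing at `o` with `l g ≤ P g` off `o` forces `l ≤ 1 - 1 / t_hit`. -/
theorem le_one_sub_of_killed {P : Matrix V V ℝ} (hP : P ∈ Matrix.rowStochastic ℝ V)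
    (hmax : MaximumPrinciple P) {l : ℝ} {o : V} {g : V → ℝ} (hg : ∀ x, 0 ≤ g x) (ho : g o = 0)
    (hne : ∃ x, g x ≠ 0) (hl : ∀ x, x ≠ o → l * g x ≤ ∑ z, P x z * g z) :
    l ≤ 1 - 1 / (maxHittingTime P hP).toReal := by
  set h : V → ℝ := fun x => (meanHit P hP x o).toReal with hh
  have hPn : ∀ x z, 0 ≤ P x z := fun x z => Matrix.nonneg_of_mem_rowStochastic hP
  have h0 : ∀ x, 0 ≤ h x := fun x => ENNReal.toReal_nonneg
  have heq : ∀ x, x ≠ o → h x = 1 + ∑ z, P x z * h z := fun x hx =>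
    toReal_meanHit_of_ne hP hmax hx
  have h1 : ∀ x, x ≠ o → 1 ≤ h x := fun x hx => one_le_toReal_meanHit hP hmax hx
  -- `M h` is the smallest multiple of `h` above `g` and touches it at `m`. There `l M h ≤ P g ≤ M P
  -- h = M (h - 1)`. At `o` the ratio is 0/0, read as 0, which is harmless.
  obtain ⟨m, -, hm⟩ := Finset.exists_max_image Finset.univ (fun x => g x / h x)
    ⟨o, Finset.mem_univ o⟩
  set M := g m / h m with hM
  have hgM : ∀ x, g x ≤ M * h x := by
    intro x
    by_cases hx : x = o
    · rw [hx, ho]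
      exact mul_nonneg (div_nonneg (hg m) (h0 m)) (h0 o)
    · have := hm x (Finset.mem_univ x)
      rwa [div_le_iff₀ (by linarith [h1 x hx])] at this
  have hMpos : 0 < M := by
    obtain ⟨x, hx⟩ := hne
    have hxo : x ≠ o := fun h => hx (h ▸ ho)
    have hx' : 0 < g x := lt_of_le_of_ne (hg x) (Ne.symm hx)
    have := hgM x
    by_contra hcon
    nlinarith [h1 x hxo]
  have hmo : m ≠ o := by
    rintro rfl
    simp [hM, ho] at hMpos
  have hmpos : 0 < h m := by linarith [h1 m hmo]
  have hgm : g m = M * h m := by rw [hM]; field_simp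
  have h2 : l * g m ≤ M * (h m - 1) := by
    refine (hl m hmo).trans ?_
    have : ∑ z, P m z * g z ≤ ∑ z, P m z * (M * h z) :=
      Finset.sum_le_sum fun z _ => mul_le_mul_of_nonneg_left (hgM z) (hPn m z)
    refine this.trans_eq ?_
    rw [heq m hmo, add_sub_cancel_left, Finset.mul_sum]
    exact Finset.sum_congr rfl fun z _ => by ring
  have h3 : l * h m ≤ h m - 1 := by
    rw [hgm] at h2
    refine le_of_mul_le_mul_left ?_ hMpos
    linarith
  have h4 : l ≤ 1 - 1 / h m := by
    rw [one_sub_div hmpos.ne', le_div_iff₀ hmpos]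
    exact h3
  have h5 : 1 / (maxHittingTime P hP).toReal ≤ 1 / h m :=
    one_div_le_one_div_of_le hmpos (toReal_meanHit_le hP hmax m o)
  linarith

/-- Eigenvalues of `P` other than `1` are at most `1 - 1 / t_hit`. -/
theorem eigenvalue_le_of_ne_one {P : Matrix V V ℝ} (hP : P ∈ Matrix.rowStochastic ℝ V)
    (hsymm : ∀ x y, P x y = P y x) (hmax : MaximumPrinciple P) {l : ℝ} (hl : l ≠ 1) {v : V → ℝ}
    (hv : v ≠ 0) (heig : ∀ x, ∑ z, P x z * v z = l * v x) :
    l ≤ 1 - 1 / (maxHittingTime P hP).toReal := by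
  obtain ⟨x₀, hx₀⟩ := Function.ne_iff.1 hv
  have hsum : ∑ x, v x = 0 := by
    have h1 : ∑ x, ∑ z, P x z * v z = ∑ z, v z := by
      rw [Finset.sum_comm]
      refine Finset.sum_congr rfl fun z _ => ?_
      rw [← Finset.sum_mul, Finset.sum_congr rfl fun x _ => hsymm x z,
        Matrix.sum_row_of_mem_rowStochastic hP z, one_mul]
    rw [Finset.sum_congr rfl fun x _ => heig x, ← Finset.mul_sum] at h1
    have : (l - 1) * ∑ x, v x = 0 := by linarith
    exact (mul_eq_zero.1 this).resolve_left (sub_ne_zero.2 hl)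
  obtain ⟨o, -, ho⟩ := Finset.exists_min_image Finset.univ v ⟨x₀, Finset.mem_univ x₀⟩
  have ho' : ∀ x, v o ≤ v x := fun x => ho x (Finset.mem_univ x)
  have hneg : v o ≤ 0 := by
    by_contra hcon
    have : 0 < ∑ x, v x :=
      Finset.sum_pos (fun x _ => (not_le.1 hcon).trans_le (ho' x)) ⟨x₀, Finset.mem_univ x₀⟩
    linarith
  -- For `g = v - v o`, the inequality `l g ≤ P g` amounts to `(1 - l) * v o ≤ 0`, so `l ≤ 1` is
  -- needed besides `v o ≤ 0`.
  by_cases hl1 : 1 < l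
  · exfalso
    obtain ⟨m, -, hm⟩ := Finset.exists_max_image Finset.univ v ⟨x₀, Finset.mem_univ x₀⟩
    have hm' : ∀ x, v x ≤ v m := fun x => hm x (Finset.mem_univ x)
    have hle : l * v m ≤ v m := by
      rw [← heig m]
      calc ∑ z, P m z * v z ≤ ∑ z, P m z * v m := Finset.sum_le_sum fun z _ =>
            mul_le_mul_of_nonneg_left (hm' z) (Matrix.nonneg_of_mem_rowStochastic hP)
        _ = v m := by rw [← Finset.sum_mul, Matrix.sum_row_of_mem_rowStochastic hP m, one_mul]
    have hvm : v m ≤ 0 := by nlinarith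
    have h0 := (Finset.sum_eq_zero_iff_of_nonpos fun x _ => (hm' x).trans hvm).1 hsum
    exact hx₀ (h0 x₀ (Finset.mem_univ x₀))
  · refine le_one_sub_of_killed hP hmax (o := o) (g := fun x => v x - v o)
      (fun x => sub_nonneg.2 (ho' x)) (sub_self _) ?_ ?_
    · by_contra! hcon
      have hconst : ∀ x, v x = v o := fun x => sub_eq_zero.1 (hcon x)
      rw [Finset.sum_congr rfl fun x _ => hconst x] at hsum
      simp only [Finset.sum_const, Finset.card_univ, nsmul_eq_mul, mul_eq_zero,
        Nat.cast_eq_zero] at hsum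
      rcases hsum with h | h
      · have : Nonempty V := ⟨x₀⟩
        exact Fintype.card_ne_zero h
      · exact hx₀ ((hconst x₀).trans h)
    · intro x _
      simp_rw [mul_sub, Finset.sum_sub_distrib, ← Finset.sum_mul]
      rw [Matrix.sum_row_of_mem_rowStochastic hP x, heig]
      nlinarith

/-- A symmetric matrix has an eigenvalue at least as large as any given Rayleigh quotient. -/
theorem exists_eigenvector_ge_rayleigh {A : Matrix V V ℝ} (hA : ∀ x y, A x y = A y x)
    {w : V → ℝ} (hw : w ≠ 0) : ∃ (μ : ℝ) (v : V → ℝ), v ≠ 0 ∧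
      (∀ x, ∑ z, A x z * v z = μ * v x) ∧
      ∑ x, w x * ∑ z, A x z * w z ≤ μ * ∑ x, w x ^ 2 := by
  have hH : A.IsHermitian := by
    ext x y
    simp [Matrix.conjTranspose_apply, hA x y]
  obtain ⟨x₀, -⟩ := Function.ne_iff.1 hw
  set b := hH.eigenvectorBasis with hb
  -- Take the largest eigenvalue and expand both quadratic forms in the orthonormal eigenbasis.
  obtain ⟨i, -, hi⟩ := Finset.exists_max_image Finset.univ hH.eigenvalues
    ⟨x₀, Finset.mem_univ x₀⟩
  have hmul := fun j => hH.mulVec_eigenvectorBasis j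
  refine ⟨hH.eigenvalues i, ⇑(b i), ?_, fun x => ?_, ?_⟩
  · intro h
    have h2 : b i = 0 := by
      ext x
      exact congrFun h x
    exact b.orthonormal.ne_zero i h2
  · exact congrFun (hmul i) x
  · set w' : EuclideanSpace ℝ V := WithLp.toLp 2 w with hw'
    set Aw : EuclideanSpace ℝ V := WithLp.toLp 2 (fun x => ∑ z, A x z * w z) with hAw
    have hin : ∀ u v : EuclideanSpace ℝ V, inner ℝ u v = ∑ x, u x * v x := by
      intro u v
      rw [PiLp.inner_apply]
      exact Finset.sum_congr rfl fun x _ => by simp [mul_comm]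
    have e1 : ∑ x, w x * ∑ z, A x z * w z = ∑ j, inner ℝ w' (b j) * inner ℝ (b j) Aw := by
      rw [b.sum_inner_mul_inner, hin]
    have e2 : ∑ x, w x ^ 2 = ∑ j, inner ℝ w' (b j) * inner ℝ (b j) w' := by
      rw [b.sum_inner_mul_inner, hin]
      exact Finset.sum_congr rfl fun x _ => by simp [hw', sq]
    have e3 : ∀ j, inner ℝ (b j) Aw = hH.eigenvalues j * inner ℝ w' (b j) := by
      intro j
      rw [hin, hin]
      have hj : ∀ z, ∑ x, A z x * b j x = hH.eigenvalues j * b j z := fun z =>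
        congrFun (hmul j) z
      calc ∑ x, b j x * ∑ z, A x z * w z
          = ∑ x, ∑ z, w z * (A z x * b j x) := Finset.sum_congr rfl fun x _ => by
            rw [Finset.mul_sum]
            exact Finset.sum_congr rfl fun z _ => by rw [hA x z]; ring
        _ = ∑ z, w z * ∑ x, A z x * b j x := by
            rw [Finset.sum_comm]
            simp_rw [Finset.mul_sum]
        _ = _ := by
            rw [Finset.mul_sum]
            refine Finset.sum_congr rfl fun z _ => ?_
            rw [hj z]
            change w z * _ = hH.eigenvalues j * (w z * _)
            ring
    rw [e1, e2, Finset.mul_sum]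
    refine Finset.sum_le_sum fun j _ => ?_
    rw [e3, real_inner_comm]
    have := hi j (Finset.mem_univ j)
    nlinarith [mul_self_nonneg (inner ℝ (b j) w')]

end SpectralBounds

/-! ### Switching a lamp, and lifting killed eigenfunctions -/

section Lamps

variable {V : Type*} [DecidableEq V]

/-- The change of `F` when the lamp at `o` is switched. -/
def lampDiff (o : V) (F : (V → ZMod 2) × V → ℝ) (f : V → ZMod 2) (x : V) : ℝ :=
  F (f, x) - F (f + Pi.single o 1, x)

theorem lampDiff_add_single (o : V) (F : (V → ZMod 2) × V → ℝ) (f : V → ZMod 2) (x : V) :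
    lampDiff o F (f + Pi.single o 1) x = - lampDiff o F f x := by
  have : f + Pi.single o 1 + Pi.single o 1 = f := by
    rw [add_assoc, ← Pi.single_add, show (1 : ZMod 2) + 1 = 0 from rfl, Pi.single_zero, add_zero]
  simp [lampDiff, this]

theorem sum_lampDiff_update_self (o : V) (F : (V → ZMod 2) × V → ℝ) (f : V → ZMod 2) (x : V) :
    ∑ b : ZMod 2, lampDiff o F (Function.update f o b) x = 0 := by
  have h : Function.update f o (1 : ZMod 2) = Function.update f o 0 + Pi.single o 1 := by
    ext z
    by_cases hz : z = o
    · subst hz; simp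
    · simp [hz]
  change ∑ b : Fin 2, lampDiff o F (Function.update f o b) x = 0
  rw [Fin.sum_univ_two]
  change lampDiff o F (Function.update f o (0 : ZMod 2)) x +
    lampDiff o F (Function.update f o (1 : ZMod 2)) x = 0
  rw [h, lampDiff_add_single, add_neg_cancel]

variable [Fintype V]

theorem lamplighterWalk_sum (P : Matrix V V ℝ) (F : (V → ZMod 2) × V → ℝ) (f : V → ZMod 2)
    (x : V) : ∑ t, lamplighterWalk P (f, x) t * F t =
      ∑ y, P x y * ∑ a : ZMod 2, ∑ b : ZMod 2,
        1 / 4 * F (Function.update (Function.update f x a) y b, y) := by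
  rw [Fintype.sum_prod_type_right]
  refine Finset.sum_congr rfl fun y _ => ?_
  simp only [lamplighterWalk, mul_assoc]
  rw [← Finset.mul_sum]
  congr 1
  simp_rw [Finset.sum_mul]
  rw [Finset.sum_comm]
  refine Finset.sum_congr rfl fun a _ => ?_
  rw [Finset.sum_comm]
  refine Finset.sum_congr rfl fun b _ => ?_
  simp [ite_mul]

/-- Switching the lamp at `o` commutes with the lamplighter walk. -/
theorem lampDiff_eigen {P : Matrix V V ℝ} {l : ℝ} {F : (V → ZMod 2) × V → ℝ}
    (hF : ∀ s, ∑ t, lamplighterWalk P s t * F t = l * F s) (o : V) (f : V → ZMod 2) (x : V) :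
    ∑ y, P x y * ∑ a : ZMod 2, ∑ b : ZMod 2,
      1 / 4 * lampDiff o F (Function.update (Function.update f x a) y b) y =
      l * lampDiff o F f x := by
  -- Updating overwrites the switch when `z = o`, so the fresh bit must be shifted as well; a
  -- uniform bit is invariant under that shift.
  have hupd : ∀ (k : V → ZMod 2) (z : V) (b : ZMod 2), Function.update (k + Pi.single o 1) z
      (b + (Pi.single o 1 : V → ZMod 2) z) = Function.update k z b + Pi.single o 1 := by
    intro k z b
    ext w
    by_cases hw : w = z
    · subst hw; simp
    · simp [hw]
  have h2 : ∑ y, P x y * ∑ a : ZMod 2, ∑ b : ZMod 2,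
      1 / 4 * F (Function.update (Function.update (f + Pi.single o 1) x a) y b, y) =
      ∑ y, P x y * ∑ a : ZMod 2, ∑ b : ZMod 2,
      1 / 4 * F (Function.update (Function.update f x a) y b + Pi.single o 1, y) := by
    refine Finset.sum_congr rfl fun y _ => ?_
    congr 1
    rw [← Equiv.sum_comp (Equiv.addRight ((Pi.single o 1 : V → ZMod 2) x))]
    refine Finset.sum_congr rfl fun a _ => ?_
    rw [← Equiv.sum_comp (Equiv.addRight ((Pi.single o 1 : V → ZMod 2) y))]
    refine Finset.sum_congr rfl fun b _ => ?_
    simp only [Equiv.coe_addRight, hupd]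
  have e1 := hF (f, x)
  have e2 := hF (f + Pi.single o 1, x)
  rw [lamplighterWalk_sum] at e1 e2
  rw [h2] at e2
  simp only [lampDiff, mul_sub, Finset.sum_sub_distrib] at *
  rw [e1, e2]

/-- If an eigenfunction of the lamplighter walk depends on some lamp, its eigenvalue is at most
`1 - 1 / t_hit`. -/
theorem eigenvalue_le_of_lampDiff {P : Matrix V V ℝ} (hP : P ∈ Matrix.rowStochastic ℝ V)
    (hmax : MaximumPrinciple P) {l : ℝ} {F : (V → ZMod 2) × V → ℝ}
    (hF : ∀ s, ∑ t, lamplighterWalk P s t * F t = l * F s) {o : V}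
    (hne : ∃ f x, lampDiff o F f x ≠ 0) (hnt : ∃ z, z ≠ o) :
    l ≤ 1 - 1 / (maxHittingTime P hP).toReal := by
  have hPn : ∀ x z, 0 ≤ P x z := fun x z => Matrix.nonneg_of_mem_rowStochastic hP
  -- For `l = 0` the lamp difference need not vanish at `o`. For all `l ≤ 0` the indicator of the
  -- complement of `o` serves as `g`.
  rcases le_or_gt l 0 with hl | hl
  · refine le_one_sub_of_killed hP hmax (o := o) (g := fun x => if x = o then 0 else 1)
      (fun x => by positivity) (by simp) ?_ ?_
    · obtain ⟨z, hz⟩ := hnt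
      exact ⟨z, by simp [hz]⟩
    · intro x hx
      have : 0 ≤ ∑ z, P x z * (if z = o then (0 : ℝ) else 1) :=
        Finset.sum_nonneg fun z _ => mul_nonneg (hPn x z) (by positivity)
      simp only [hx, if_false]
      linarith
  set g : V → ℝ := fun x => Finset.univ.sup' Finset.univ_nonempty fun f => |lampDiff o F f x|
    with hg
  have hle : ∀ f x, |lampDiff o F f x| ≤ g x := fun f x =>
    Finset.le_sup' (fun f => |lampDiff o F f x|) (Finset.mem_univ f)
  have heig := lampDiff_eigen hF o
  refine le_one_sub_of_killed hP hmax (o := o) (g := g)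
    (fun x => (abs_nonneg _).trans (hle 0 x)) ?_ ?_ ?_
  -- From `o`, the lamp there is randomised before the move, and again after it if the walker stays.
  -- Either way the antisymmetric difference averages to 0, and `l ≠ 0`.
  · have hz : ∀ f, lampDiff o F f o = 0 := by
      intro f
      have h1 := heig f o
      have h2 : ∑ y, P o y * ∑ a : ZMod 2, ∑ b : ZMod 2,
          1 / 4 * lampDiff o F (Function.update (Function.update f o a) y b) y = 0 := by
        refine Finset.sum_eq_zero fun y _ => ?_
        by_cases hy : y = o
        · subst hy
          simp_rw [← Finset.mul_sum, sum_lampDiff_update_self]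
          simp
        · rw [Finset.sum_comm]
          simp_rw [fun a b => Function.update_comm (Ne.symm hy) a b f, ← Finset.mul_sum,
            sum_lampDiff_update_self]
          simp
      rw [h2] at h1
      exact (mul_eq_zero.1 h1.symm).resolve_left hl.ne'
    simp [hg, hz]
  · obtain ⟨f, x, hfx⟩ := hne
    exact ⟨x, ((abs_pos.2 hfx).trans_le (hle f x)).ne'⟩
  · intro x _
    obtain ⟨f, -, hf⟩ := Finset.exists_mem_eq_sup' (Finset.univ_nonempty (α := V → ZMod 2))
      fun f => |lampDiff o F f x|
    have hf' : g x = |lampDiff o F f x| := hf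
    have hlg : l * g x = |l * lampDiff o F f x| := by rw [hf', abs_mul, abs_of_pos hl]
    rw [hlg, ← heig f x]
    refine (Finset.abs_sum_le_sum_abs _ _).trans (Finset.sum_le_sum fun y _ => ?_)
    rw [abs_mul, abs_of_nonneg (hPn x y)]
    refine mul_le_mul_of_nonneg_left ?_ (hPn x y)
    calc |∑ a : ZMod 2, ∑ b : ZMod 2,
          1 / 4 * lampDiff o F (Function.update (Function.update f x a) y b) y|
        ≤ ∑ a : ZMod 2, ∑ b : ZMod 2, 1 / 4 * g y := by
          refine (Finset.abs_sum_le_sum_abs _ _).trans (Finset.sum_le_sum fun a _ => ?_)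
          refine (Finset.abs_sum_le_sum_abs _ _).trans (Finset.sum_le_sum fun b _ => ?_)
          rw [abs_mul, abs_of_pos (by norm_num : (0 : ℝ) < 1 / 4)]
          exact mul_le_mul_of_nonneg_left (hle _ y) (by norm_num)
      _ = g y := by simp [ZMod.card]; ring

/-- A function insensitive to switching any single lamp does not depend on the lamps. -/
theorem eq_of_lampDiff_eq_zero {F : (V → ZMod 2) × V → ℝ}
    (h : ∀ o f x, lampDiff o F f x = 0) (f : V → ZMod 2) (x : V) : F (f, x) = F (0, x) := by
  have hstep : ∀ (o : V) (c : ZMod 2) (k : V → ZMod 2), F (k + Pi.single o c, x) = F (k, x) := by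
    intro o c k
    have hc : c = 0 ∨ c = 1 := by
      revert c; decide
    rcases hc with rfl | rfl
    · simp
    · exact (sub_eq_zero.1 (h o k x)).symm
  have hsum : ∀ s : Finset V, F (∑ o ∈ s, Pi.single o (f o), x) = F (0, x) := by
    intro s
    induction s using Finset.induction_on with
    | empty => simp
    | insert o s ho ih => rw [Finset.sum_insert ho, add_comm, hstep, ih]
  rw [← hsum Finset.univ, Finset.univ_sum_single]

/-- A function of the position only is mapped by the lamplighter walk as by the base walk. -/
theorem lamplighterWalk_sum_of_position (P : Matrix V V ℝ) (v : V → ℝ)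
    (s : (V → ZMod 2) × V) :
    ∑ t, lamplighterWalk P s t * v t.2 = ∑ y, P s.2 y * v y := by
  obtain ⟨f, x⟩ := s
  rw [lamplighterWalk_sum P (fun t => v t.2)]
  refine Finset.sum_congr rfl fun y _ => ?_
  simp [ZMod.card]
  ring_nf
  simp

/-- The sign `(-1)^a` of a lamp state. -/
def lampSign (a : ZMod 2) : ℝ := if a = 0 then 1 else -1

theorem sum_lampSign : ∑ a : ZMod 2, lampSign a = 0 := by
  refine (Fin.sum_univ_two (fun a : Fin 2 => lampSign a)).trans ?_
  change lampSign (0 : ZMod 2) + lampSign (1 : ZMod 2) = 0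
  simp [lampSign]

/-- An eigenfunction of the walk killed at `o` lifts to one of the lamplighter walk. -/
theorem lamplighterWalk_sum_sign {P : Matrix V V ℝ} {o : V} {μ : ℝ} {v : V → ℝ} (ho : v o = 0)
    (hv : ∀ x, x ≠ o → ∑ z, P x z * v z = μ * v x) (s : (V → ZMod 2) × V) :
    ∑ t, lamplighterWalk P s t * (lampSign (t.1 o) * v t.2) =
      μ * (lampSign (s.1 o) * v s.2) := by
  obtain ⟨f, x⟩ := s
  rw [lamplighterWalk_sum P (fun t => lampSign (t.1 o) * v t.2)]
  by_cases hx : x = o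
  · subst hx
    simp only [ho, mul_zero]
    -- A step staying at `o` has weight `v o = 0`; for any other step the lamp at `o` has just been
    -- randomised, so the sign averages out.
    refine Finset.sum_eq_zero fun y _ => ?_
    by_cases hy : y = x
    · simp [hy, ho]
    · simp_rw [Function.update_of_ne (Ne.symm hy), Function.update_self, Finset.sum_const,
        ← Finset.smul_sum, ← Finset.mul_sum, ← Finset.sum_mul, sum_lampSign]
      simp
  · have : ∀ y, P x y * ∑ a : ZMod 2, ∑ b : ZMod 2, 1 / 4 *
        (lampSign (Function.update (Function.update f x a) y b o) * v y) =
        lampSign (f o) * (P x y * v y) := by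
      intro y
      by_cases hy : y = o
      · simp [hy, ho]
      · simp_rw [Function.update_of_ne (Ne.symm hy), Function.update_of_ne (Ne.symm hx)]
        simp [ZMod.card]
        ring
    simp only [this]
    rw [← Finset.mul_sum, hv x hx]
    ring

end Lamps

/-! ### The two bounds on the relaxation time -/

section RelaxationTime

variable {V : Type*} [Fintype V] [DecidableEq V]

/-- The eigenvalues over which `secondEigenvalue` is the supremum. -/
def nontrivialEigenvalues {S : Type*} [Fintype S] [DecidableEq S] (P : Matrix S S ℝ) : Set ℝ :=
  {l : ℝ | Module.End.HasEigenvalue (Matrix.toLin' P) l ∧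
    (l = 1 → 2 ≤ Module.finrank ℝ (Module.End.eigenspace (Matrix.toLin' P) 1))}

theorem mem_eigenspace_toLin'_iff {S : Type*} [Fintype S] [DecidableEq S] {P : Matrix S S ℝ}
    {l : ℝ} {F : S → ℝ} : F ∈ Module.End.eigenspace (Matrix.toLin' P) l ↔
      ∀ s, ∑ t, P s t * F t = l * F s := by
  rw [Module.End.mem_eigenspace_iff, Matrix.toLin'_apply, funext_iff]
  rfl

variable {P : Matrix V V ℝ} [Nontrivial V]

/-- Every eigenvalue of the lamplighter walk other than one copy of `1` is at most
`1 - 1 / t_hit`. -/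
theorem nontrivialEigenvalues_lamplighterWalk_le (hP : P ∈ Matrix.rowStochastic ℝ V)
    (hsymm : ∀ x y, P x y = P y x) (hmax : MaximumPrinciple P)
    (hT : 0 < (maxHittingTime P hP).toReal) {l : ℝ}
    (hl : l ∈ nontrivialEigenvalues (lamplighterWalk P)) :
    l ≤ 1 - 1 / (maxHittingTime P hP).toReal := by
  obtain ⟨hl1, hl2⟩ := hl
  obtain ⟨F, hF, hF0⟩ := hl1.exists_hasEigenvector
  rw [mem_eigenspace_toLin'_iff] at hF
  by_cases hdiff : ∃ o f x, lampDiff o F f x ≠ 0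
  · obtain ⟨o, hne⟩ := hdiff
    exact eigenvalue_le_of_lampDiff hP hmax hF hne (exists_ne o)
  have hpos : ∀ (H : (V → ZMod 2) × V → ℝ), (¬ ∃ o f x, lampDiff o H f x ≠ 0) → ∀ l : ℝ,
      (∀ s, ∑ t, lamplighterWalk P s t * H t = l * H s) →
      (∀ s, H s = H (0, s.2)) ∧ ∀ x, ∑ z, P x z * H (0, z) = l * H (0, x) := by
    intro H hH l hl
    push Not at hH
    have h1 : ∀ s, H s = H (0, s.2) := fun s => eq_of_lampDiff_eq_zero hH s.1 s.2
    refine ⟨h1, fun x => ?_⟩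
    rw [← hl (0, x), ← lamplighterWalk_sum_of_position P (fun z => H (0, z)) (0, x)]
    exact Finset.sum_congr rfl fun t _ => by rw [h1 t]
  by_cases hl : l = 1
  · exfalso
    have hfin := hl2 hl
    -- The eigenvalue 1 is simple: an eigenfunction depending on a lamp would have eigenvalue below
    -- 1, and one of the position only is harmonic, hence constant.
    have hle : Module.finrank ℝ
        (Module.End.eigenspace (Matrix.toLin' (lamplighterWalk P)) 1) ≤ 1 := by
      refine finrank_le_one (⟨fun _ => 1, ?_⟩ :
        Module.End.eigenspace (Matrix.toLin' (lamplighterWalk P)) 1) ?_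
      · rw [mem_eigenspace_toLin'_iff]
        intro s
        have := lamplighterWalk_sum_of_position P (fun _ => (1 : ℝ)) s
        simpa [Matrix.sum_row_of_mem_rowStochastic hP] using this
      · rintro ⟨H, hH⟩
        rw [mem_eigenspace_toLin'_iff] at hH
        by_cases hd : ∃ o f x, lampDiff o H f x ≠ 0
        · exfalso
          obtain ⟨o, hne⟩ := hd
          have := eigenvalue_le_of_lampDiff hP hmax hH hne (exists_ne o)
          have : 0 < 1 / (maxHittingTime P hP).toReal := by positivity
          linarith
        · obtain ⟨h1, h2⟩ := hpos H hd 1 hH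
          obtain ⟨o⟩ : Nonempty V := inferInstance
          refine ⟨H (0, o), ?_⟩
          ext s
          have h3 : H (0, s.2) = H (0, o) :=
            hmax.eq_of_harmonic (u := fun z => H (0, z)) (fun x => by rw [h2 x, one_mul]) s.2 o
          change H (0, o) * 1 = H s
          rw [mul_one, h1 s, h3]
    omega
  · obtain ⟨h1, h2⟩ := hpos F hdiff l hF
    refine eigenvalue_le_of_ne_one hP hsymm hmax hl (v := fun z => F (0, z)) ?_ h2
    intro hv
    refine hF0 (funext fun s => ?_)
    rw [h1 s]
    exact congrFun hv s.2

theorem toReal_maxHittingTime_pos (hP : P ∈ Matrix.rowStochastic ℝ V)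
    (hmax : MaximumPrinciple P) : 0 < (maxHittingTime P hP).toReal := by
  obtain ⟨x, o, hx⟩ := exists_pair_ne V
  linarith [one_le_toReal_meanHit hP hmax hx, toReal_meanHit_le hP hmax x o]

/-- The lamplighter walk has an eigenvalue `l < 1` with `1 / (1 - l)` at least `t_hit / 2`. -/
theorem exists_mem_nontrivialEigenvalues (hP : P ∈ Matrix.rowStochastic ℝ V)
    (hsymm : ∀ x y, P x y = P y x) (hmax : MaximumPrinciple P) (hlazy : ∀ x, P x x = 1 / 2) :
    ∃ l ∈ nontrivialEigenvalues (lamplighterWalk P),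
      l < 1 ∧ (maxHittingTime P hP).toReal / 2 ≤ 1 / (1 - l) := by
  have hPn : ∀ x z, 0 ≤ P x z := fun x z => Matrix.nonneg_of_mem_rowStochastic hP
  have hTpos := toReal_maxHittingTime_pos hP hmax
  have hn : (0 : ℝ) < Fintype.card V := by exact_mod_cast Fintype.card_pos
  obtain ⟨o, ho⟩ := exists_maxHittingTime_le hP hsymm hmax
  set T := (maxHittingTime P hP).toReal with hT
  set h : V → ℝ := fun x => (meanHit P hP x o).toReal with hh
  have h0 : ∀ x, 0 ≤ h x := fun x => ENNReal.toReal_nonneg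
  have hoo : h o = 0 := toReal_meanHit_self hP o
  have heq : ∀ x, x ≠ o → h x = 1 + ∑ z, P x z * h z := fun x hx =>
    toReal_meanHit_of_ne hP hmax hx
  -- Holding with probability 1/2 gives `h x ≥ 1 + h x / 2`. This makes the Rayleigh quotient of `h`
  -- positive, hence `μ > 0`.
  have h2 : ∀ x, x ≠ o → 2 ≤ h x := fun x hx => by
    have h1 : P x x * h x ≤ ∑ z, P x z * h z :=
      Finset.single_le_sum (f := fun z => P x z * h z)
        (fun z _ => mul_nonneg (hPn x z) (h0 z)) (Finset.mem_univ x)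
    rw [hlazy] at h1
    linarith [heq x hx]
  have hne : h ≠ 0 := by
    obtain ⟨x, hx⟩ := exists_ne o
    intro hcon
    have := h2 x hx
    rw [hcon] at this
    norm_num at this
  -- Deleting both row and column keeps `K` symmetric; its zero row at `o` forces `v o = 0` once `μ
  -- ≠ 0`.
  let K : Matrix V V ℝ := fun x z => if x = o ∨ z = o then 0 else P x z
  have hKP : ∀ u : V → ℝ, u o = 0 → ∀ x, x ≠ o → ∑ z, K x z * u z = ∑ z, P x z * u z := by
    intro u hu x hx
    refine Finset.sum_congr rfl fun z _ => ?_
    by_cases hz : z = o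
    · rw [hz, hu, mul_zero, mul_zero]
    · simp [K, hx, hz]
  obtain ⟨μ, v, hv0, hv, hR⟩ := exists_eigenvector_ge_rayleigh (A := K)
    (fun x y => by simp only [K, hsymm x y, or_comm]) hne
  have hRay : ∑ x, h x * ∑ z, K x z * h z = ∑ x, h x ^ 2 - ∑ x, h x := by
    rw [← Finset.sum_sub_distrib]
    refine Finset.sum_congr rfl fun x _ => ?_
    by_cases hx : x = o
    · simp [hx, hoo]
    · rw [hKP h hoo x hx, show ∑ z, P x z * h z = h x - 1 by linarith [heq x hx]]
      ring
  have hS2 : 2 * ∑ x, h x ≤ ∑ x, h x ^ 2 := by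
    rw [Finset.mul_sum]
    refine Finset.sum_le_sum fun x _ => ?_
    by_cases hx : x = o
    · simp [hx, hoo]
    · nlinarith [h2 x hx]
  have hSpos : 0 < ∑ x, h x := by
    have : 0 < Fintype.card V * T := mul_pos hn hTpos
    linarith
  have hμ : 0 < μ := by
    rw [hRay] at hR
    by_contra hcon
    nlinarith
  have hvo : v o = 0 := by
    have := hv o
    simp only [K, true_or, if_true, zero_mul, Finset.sum_const_zero] at this
    exact (mul_eq_zero.1 this.symm).resolve_left hμ.ne'
  have hvP : ∀ x, x ≠ o → ∑ z, P x z * v z = μ * v x := fun x hx => by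
    rw [← hKP v hvo x hx, hv x]
  obtain ⟨x₁, hx₁⟩ := Function.ne_iff.1 hv0
  have hμ1 : μ < 1 := by
    have := le_one_sub_of_killed hP hmax (l := μ) (o := o) (g := fun x => |v x|)
      (fun x => abs_nonneg _) (by simp [hvo]) ⟨x₁, by simpa using hx₁⟩ (fun x hx => by
        have hμv : μ * |v x| = |μ * v x| := by rw [abs_mul, abs_of_pos hμ]
        rw [hμv, ← hvP x hx]
        refine (Finset.abs_sum_le_sum_abs _ _).trans_eq (Finset.sum_congr rfl fun z _ => ?_)
        rw [abs_mul, abs_of_nonneg (hPn x z)])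
    have hpos : 0 < 1 / T := by positivity
    linarith
  refine ⟨μ, ⟨?_, fun h => absurd h hμ1.ne⟩, hμ1, ?_⟩
  · refine Module.End.hasEigenvalue_of_hasEigenvector
      (x := fun s : (V → ZMod 2) × V => lampSign (s.1 o) * v s.2) ⟨?_, ?_⟩
    · rw [mem_eigenspace_toLin'_iff]
      exact lamplighterWalk_sum_sign hvo hvP
    · intro hcon
      have := congrFun hcon (0, x₁)
      simp only [lampSign, Pi.zero_apply, if_true, one_mul] at this
      exact hx₁ this
  · rw [le_div_iff₀ (by linarith)]
    -- With `n` the number of vertices: `1 - μ ≤ ∑ h / ∑ h² ≤ n / ∑ h ≤ 2 / T`, by the Rayleigh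
    -- bound, Cauchy–Schwarz and the choice of `o`.
    have hcs : (∑ x, h x) ^ 2 ≤ Fintype.card V * ∑ x, h x ^ 2 := by
      simpa using sq_sum_le_card_mul_sum_sq (s := Finset.univ) (f := h)
    rw [hRay] at hR
    have hA : (1 - μ) * ∑ x, h x ^ 2 ≤ ∑ x, h x := by linarith
    have hQ : 0 < ∑ x, h x ^ 2 := by linarith
    have hc : 0 < Fintype.card V * ∑ x, h x ^ 2 := mul_pos hn hQ
    have hA0 : 0 ≤ (1 - μ) * ∑ x, h x ^ 2 := mul_nonneg (by linarith) hQ.le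
    have hB : (Fintype.card V * T) * ((1 - μ) * ∑ x, h x ^ 2) ≤
        (2 * ∑ x, h x) * ∑ x, h x :=
      mul_le_mul ho hA hA0 (by linarith)
    refine le_of_mul_le_mul_right ?_ hc
    nlinarith

theorem relaxationTime_lamplighterWalk_bounds (hP : P ∈ Matrix.rowStochastic ℝ V)
    (hsymm : ∀ x y, P x y = P y x) (hmax : MaximumPrinciple P) (hlazy : ∀ x, P x x = 1 / 2) :
    (maxHittingTime P hP).toReal / 2 ≤ relaxationTime (lamplighterWalk P) ∧
      relaxationTime (lamplighterWalk P) ≤ (maxHittingTime P hP).toReal := by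
  have hT := toReal_maxHittingTime_pos hP hmax
  have hT' : 0 < 1 / (maxHittingTime P hP).toReal := by positivity
  have hub := fun l (hl : l ∈ nontrivialEigenvalues (lamplighterWalk P)) =>
    nontrivialEigenvalues_lamplighterWalk_le hP hsymm hmax hT hl
  obtain ⟨l, hl, hl1, hl2⟩ := exists_mem_nontrivialEigenvalues hP hsymm hmax hlazy
  -- The real supremum is meaningful only for a nonempty set bounded above: the lower-bound
  -- eigenvalue supplies the first, the upper bound the second.
  have hle : secondEigenvalue (lamplighterWalk P) ≤ 1 - 1 / (maxHittingTime P hP).toReal :=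
    csSup_le ⟨l, hl⟩ hub
  have hge : l ≤ secondEigenvalue (lamplighterWalk P) := le_csSup ⟨_, hub⟩ hl
  unfold relaxationTime
  constructor
  · exact hl2.trans (one_div_le_one_div_of_le (by linarith) (by linarith))
  · calc 1 / (1 - secondEigenvalue (lamplighterWalk P))
        ≤ 1 / (1 / (maxHittingTime P hP).toReal) :=
          one_div_le_one_div_of_le hT' (by linarith)
      _ = _ := one_div_one_div _

end RelaxationTime

end Lamplighter

end

theorem mainTheorem2 :
    ∃ c₁ C₁ : ℝ, 0 < c₁ ∧ c₁ ≤ C₁ ∧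
      ∀ (V : Type*) [Fintype V] [DecidableEq V] [Nontrivial V]
        (G : SimpleGraph V) [DecidableRel G.Adj] (d : ℕ) (_hreg : G.IsRegularOfDegree d)
        (hconn : G.Connected),
        let tHit : ℝ≥0∞ := Lamplighter.maxHittingTime (Lamplighter.lazyWalk G)
          (Lamplighter.lazyWalk_mem_rowStochastic G hconn)
        let tRel : ℝ := Lamplighter.relaxationTime (Lamplighter.lazyWalk G)
        let tRelLamp : ℝ := Lamplighter.relaxationTime
          (Lamplighter.lamplighterWalk (Lamplighter.lazyWalk G))
        tHit ≠ ⊤ ∧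
        c₁ * tHit.toReal ≤ tRelLamp ∧
        tRelLamp ≤ C₁ * tHit.toReal ∧
        tRelLamp ≤ max (4 / Real.log 2 * tHit.toReal) (2 * tRel) := by
  refine ⟨1 / 2, 1, by norm_num, by norm_num, ?_⟩
  intro V _ _ _ G _ d hreg hconn tHit tRel tRelLamp
  have hmax := Lamplighter.lazyWalk_maximumPrinciple G hconn
  obtain ⟨hlow, hup⟩ := Lamplighter.relaxationTime_lamplighterWalk_bounds
    (Lamplighter.lazyWalk_mem_rowStochastic G hconn) (Lamplighter.lazyWalk_symm G hreg) hmax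
    (fun x => by simp [Lamplighter.lazyWalk])
  refine ⟨Lamplighter.maxHittingTime_ne_top _ hmax, ?_, ?_, ?_⟩
  · change tHit.toReal / 2 ≤ tRelLamp at hlow
    linarith
  · rw [one_mul]
    exact hup
  -- The first term of the maximum suffices, because log 2 < 1 < 4.
  · refine le_max_of_le_left (le_trans hup ?_)
    change tHit.toReal ≤ _
    have hlog : 0 < Real.log 2 := Real.log_pos (by norm_num)
    have hlog' : Real.log 2 < 1 := by linarith [Real.log_two_lt_d9]
    have h4 : 1 ≤ 4 / Real.log 2 := by
      rw [le_div_iff₀ hlog]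
      linarith
    exact le_mul_of_one_le_left ENNReal.toReal_nonneg h4
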